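/- Let $\Omega\subset\mathbb R^d$ be an open set (in particular, any smooth domain with $d=1,2,3$), let $\alpha\in(0,1)$, $\kappa\in\mathbb R$, $T>0$, $N\in\mathbb N$ with $N\ge1$, and $\tau=T/N$. Put $\omega_j=(-1)^j\frac{\alpha(\alpha-1)\cdots(\alpha-j+1)}{j!}$ for $j\ge0$. For functions $u_0,u_1,\dots,u_N$ on $\Omega$ and $1\le n\le N$ let $$\bar\partial_\tau^\alpha u_n=\tau^{-\alpha}\sum_{j=1}^n\omega_{n-j}(u_j-u_0),\qquad u_{n,\alpha}=\omega_0u_0-\sum_{j=1}^{n-1}\omega_{n-j}(u_j-u_0),$$ so that $u_n-u_{n,\alpha}=\tau^\alpha\bar\partial_\tau^\alpha u_n$. The homogeneous Dirichlet problem is understood as follows: $u_n\in H_0^1(\Omega)$, the weak Laplacian $\Delta u_n$ belongs to $L^2(\Omega)$, that is, $\int_\Omega\nabla u_n\cdot\nabla v=-\int_\Omega(\Delta u_n)v$ for all $v\in H_0^1(\Omega)$, and the equation holds almost everywhere in $\Omega$. (i) (Weighted convex splitting scheme.) If $u_0$ is measurable and $u_1,\dots,u_N$ satisfy, with the homogeneous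 Dirichlet boundary condition, $$\bar\partial_\tau^\alpha u_n-\kappa^2\Delta u_n=u_{n,\alpha}-(u_n)^3,\qquad 1\le n\le N,$$ then, without any condition on $\tau$, $$\|u_0\|_{L^\infty(\Omega)}\le1\quad\Longrightarrow\quad\|u_n\|_{L^\infty(\Omega)}\le1\ \text{ for all } 1\le n\le N.$$ (ii) (Linear weighted stabilized scheme.) Let $S>0$ satisfy $S+\tau^{-\alpha}\ge2$. If $u_0$ is measurable and $u_1,\dots,u_N$ satisfy, with the homogeneous Dirichlet boundary condition, $$\bar\partial_\tau^\alpha u_n-\kappa^2\Delta u_n=u_{n,\alpha}-(u_{n,\alpha})^3-S(u_n-u_{n,\alpha}),\qquad 1\le n\le N,$$ then $$\|u_0\|_{L^\infty(\Omega)}\le1\quad\Longrightarrow\quad\|u_n\|_{L^\infty(\Omega)}\le1\ \text{ for all } 1\le n\le N.$$ -/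

import Mathlib

open MeasureTheory Filter Topology Set
open scoped ContDiff ENNReal Gradient

namespace FracAllenCahn

/-- The space `ℝ^d` with its Euclidean norm. -/
abbrev E (d : ℕ) : Type := EuclideanSpace ℝ (Fin d)

/-- `φ ∈ C_c^∞(Ω)`. -/
def IsTestFunction {d : ℕ} (Ω : Set (E d)) (φ : E d → ℝ) : Prop :=
  ContDiff ℝ ∞ φ ∧ HasCompactSupport φ ∧ tsupport φ ⊆ Ω

/-- `u ∈ H_0^1(Ω)` with weak gradient `G`, where `H_0^1(Ω)` is the closure of `C_c^∞(Ω)` in the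
`H^1`-norm: `(u, G)` is the limit of pairs `(φ, ∇φ)` in `L^2(Ω) × L^2(Ω; ℝ^d)`. -/
structure IsH10 {d : ℕ} (Ω : Set (E d)) (u : E d → ℝ) (G : E d → E d) : Prop where
  memLp : MemLp u 2 (volume.restrict Ω)
  memLp_grad : MemLp G 2 (volume.restrict Ω)
  approx : ∃ φ : ℕ → E d → ℝ, (∀ k, IsTestFunction Ω (φ k)) ∧
    Tendsto (fun k => eLpNorm (fun x => u x - φ k x) 2 (volume.restrict Ω)) atTop (𝓝 0) ∧
    Tendsto (fun k => eLpNorm (fun x => G x - ∇ (φ k) x) 2 (volume.restrict Ω)) atTop (𝓝 0)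

/-- `w` satisfies the homogeneous Dirichlet boundary condition (`w ∈ H_0^1(Ω)`) and its weak
Laplacian is `L ∈ L^2(Ω)`: `∫_Ω ∇w · ∇v = - ∫_Ω L v` for all `v ∈ H_0^1(Ω)`.
This is the graph of the Dirichlet Laplacian on `L^2(Ω)`, whose domain is
`H^2(Ω) ∩ H_0^1(Ω)` when `Ω` is bounded and smooth. -/
def IsDirichletLaplacian {d : ℕ} (Ω : Set (E d)) (w L : E d → ℝ) : Prop :=
  MemLp L 2 (volume.restrict Ω) ∧
  ∃ G : E d → E d, IsH10 Ω w G ∧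
    ∀ (v : E d → ℝ) (H : E d → E d), IsH10 Ω v H →
      ∫ x in Ω, inner ℝ (G x) (H x) = - ∫ x in Ω, L x * v x

/-- The weights `ω_j = (-1)^j α (α - 1) ⋯ (α - j + 1) / j!`. -/
noncomputable def weight (α : ℝ) (j : ℕ) : ℝ :=
  (-1) ^ j * (∏ i ∈ Finset.range j, (α - (i : ℝ))) / (j.factorial : ℝ)

/-- The discrete fractional derivative
`∂̄_τ^α u_n = τ^{-α} ∑_{j=1}^n ω_{n-j} (u_j - u_0)`. -/
noncomputable def discreteCaputo {X : Type*} (α τ : ℝ) (u : ℕ → X → ℝ) (n : ℕ) (x : X) : ℝ :=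
  τ ^ (-α) * ∑ j ∈ Finset.Icc 1 n, weight α (n - j) * (u j x - u 0 x)

/-- The fractional extrapolation
`u_{n,α} = ω_0 u_0 - ∑_{j=1}^{n-1} ω_{n-j} (u_j - u_0)`, for `n ≥ 1`. -/
noncomputable def fracExtrap {X : Type*} (α : ℝ) (u : ℕ → X → ℝ) (n : ℕ) (x : X) : ℝ :=
  weight α 0 * u 0 x - ∑ j ∈ Finset.Ico 1 n, weight α (n - j) * (u j x - u 0 x)

/-- `u_0, …, u_N` solves the weighted convex splitting scheme
`∂̄_τ^α u_n - κ² Δ u_n = u_{n,α} - (u_n)³` in `Ω`, `u_n = 0` on `∂Ω`, for `1 ≤ n ≤ N`. -/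
def IsWCS {d : ℕ} (Ω : Set (E d)) (α κ τ : ℝ) (N : ℕ) (u : ℕ → E d → ℝ) : Prop :=
  ∀ n : ℕ, 1 ≤ n → n ≤ N → ∃ L : E d → ℝ, IsDirichletLaplacian Ω (u n) L ∧
    ∀ᵐ x ∂(volume.restrict Ω),
      discreteCaputo α τ u n x - κ ^ 2 * L x = fracExtrap α u n x - u n x ^ 3

/-- `u_0, …, u_N` solves the linear weighted stabilized scheme
`∂̄_τ^α u_n - κ² Δ u_n = u_{n,α} - (u_{n,α})³ - S (u_n - u_{n,α})` in `Ω`, `u_n = 0` on `∂Ω`,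
for `1 ≤ n ≤ N`. -/
def IsLWS {d : ℕ} (Ω : Set (E d)) (α κ τ S : ℝ) (N : ℕ) (u : ℕ → E d → ℝ) : Prop :=
  ∀ n : ℕ, 1 ≤ n → n ≤ N → ∃ L : E d → ℝ, IsDirichletLaplacian Ω (u n) L ∧
    ∀ᵐ x ∂(volume.restrict Ω),
      discreteCaputo α τ u n x - κ ^ 2 * L x =
        fracExtrap α u n x - fracExtrap α u n x ^ 3 - S * (u n x - fracExtrap α u n x)

end FracAllenCahn

namespace FracAllenCahn

/-! ### The weights `ω_j` and the fractional extrapolation -/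

/-! Since `ω_0 = 1`, `ω_j ≤ 0` for `j ≥ 1` and all partial sums of the weights are nonnegative,
`u_{n,α}` is a convex combination of `u_0, …, u_{n-1}`; by strong induction `|u_{n,α}| ≤ 1` almost
everywhere (`abs_fracExtrap_le_one`). Each scheme then forces `κ²Δu_n > 0` where `u_n > 1` and
`κ²Δu_n < 0` where `u_n < -1`.

Test the weak Laplacian with `F(u_n)`, where `F` is smooth and nondecreasing and vanishes exactly on
`[-1, 1]`. Then `∫ Δu_n F(u_n) = -∫ F'(u_n)|∇u_n|² ≤ 0`, although `κ²Δu_n F(u_n)` is positive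
wherever `|u_n| > 1`; that set is therefore null (`IsDirichletLaplacian.ae_abs_le_one`). Taking `F`
smooth rather than a positive part makes the chain rule in `H_0^1` elementary (`IsH10.comp`). -/

lemma weight_zero (α : ℝ) : weight α 0 = 1 := by
  simp [weight]

lemma weight_succ (α : ℝ) (j : ℕ) :
    weight α (j + 1) = weight α j * ((j - α) / (j + 1)) := by
  have h : ((j : ℝ) + 1) ≠ 0 := by positivity
  have h' : (j.factorial : ℝ) ≠ 0 := by positivity
  simp only [weight, Finset.prod_range_succ, Nat.factorial_succ, pow_succ]
  push_cast
  field_simp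
  ring

lemma weight_succ_nonpos {α : ℝ} (h0 : 0 < α) (h1 : α < 1) (j : ℕ) : weight α (j + 1) ≤ 0 := by
  induction j with
  | zero => rw [weight_succ, weight_zero]; simp [h0.le]
  | succ j ih =>
    rw [weight_succ]
    refine mul_nonpos_of_nonpos_of_nonneg ih (div_nonneg ?_ (by positivity))
    push_cast
    have : (0 : ℝ) ≤ j := j.cast_nonneg
    linarith

/-- The recurrence gives `α ω_k = k ω_k - (k+1) ω_{k+1}`, so the sum telescopes. The sign of a
partial sum is thus read off from the next weight. -/
lemma alpha_mul_sum_weight (α : ℝ) (m : ℕ) :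
    α * ∑ j ∈ Finset.range (m + 1), weight α j = -((m + 1) * weight α (m + 1)) := by
  induction m with
  | zero => simp [weight_succ, weight_zero]
  | succ m ih =>
    have h : ((m : ℝ) + 1 + 1) ≠ 0 := by positivity
    rw [Finset.sum_range_succ, mul_add, ih, weight_succ α (m + 1)]
    push_cast
    field_simp
    ring

lemma sum_weight_nonneg {α : ℝ} (h0 : 0 < α) (h1 : α < 1) (m : ℕ) :
    0 ≤ ∑ j ∈ Finset.range (m + 1), weight α j := by
  have h := alpha_mul_sum_weight α m
  have h2 := weight_succ_nonpos h0 h1 m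
  refine nonneg_of_mul_nonneg_right (b := ∑ j ∈ Finset.range (m + 1), weight α j) ?_ h0
  rw [h]
  have : (0 : ℝ) ≤ m + 1 := by positivity
  nlinarith

/-- This is the partial sum `ω_0 + ⋯ + ω_{n-1}` in reverse order, and the coefficient of `u_0` in
`u_{n,α}`. -/
lemma one_add_sum_weight_nonneg {α : ℝ} (h0 : 0 < α) (h1 : α < 1) {n : ℕ} (hn : 1 ≤ n) :
    0 ≤ 1 + ∑ j ∈ Finset.Ico 1 n, weight α (n - j) := by
  obtain ⟨m, rfl⟩ := Nat.exists_eq_add_of_le' hn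
  have h := sum_weight_nonneg h0 h1 m
  rw [Finset.sum_range_succ', weight_zero,
    ← Finset.sum_range_reflect (fun k => weight α (k + 1))] at h
  have e : ∑ k ∈ Finset.Ico 1 (m + 1), weight α (m + 1 - k) =
      ∑ k ∈ Finset.range m, weight α (m - 1 - k + 1) := by
    rw [Finset.sum_Ico_eq_sum_range]
    refine Finset.sum_congr (by simp) fun k hk => ?_
    rw [Finset.mem_range] at hk
    congr 1
    omega
  rw [e]
  linarith

/-- The fractional extrapolation is a convex combination of the previous values. -/
lemma abs_fracExtrap_le_one {X : Type*} {α : ℝ} (h0 : 0 < α) (h1 : α < 1) {u : ℕ → X → ℝ}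
    {n : ℕ} (hn : 1 ≤ n) {x : X} (hu : ∀ j < n, |u j x| ≤ 1) : |fracExtrap α u n x| ≤ 1 := by
  have e : fracExtrap α u n x = (1 + ∑ j ∈ Finset.Ico 1 n, weight α (n - j)) * u 0 x +
      ∑ j ∈ Finset.Ico 1 n, -weight α (n - j) * u j x := by
    simp only [fracExtrap, weight_zero, mul_sub, Finset.sum_sub_distrib, add_mul, Finset.sum_mul,
      neg_mul, Finset.sum_neg_distrib]
    ring
  have hw := one_add_sum_weight_nonneg h0 h1 hn
  have hs : |∑ j ∈ Finset.Ico 1 n, -weight α (n - j) * u j x| ≤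
      ∑ j ∈ Finset.Ico 1 n, -weight α (n - j) := by
    refine (Finset.abs_sum_le_sum_abs _ _).trans (Finset.sum_le_sum fun j hj => ?_)
    rw [Finset.mem_Ico] at hj
    obtain ⟨k, hk⟩ : ∃ k, n - j = k + 1 := ⟨n - j - 1, by omega⟩
    have hk' := weight_succ_nonpos h0 h1 k
    rw [hk, abs_mul, abs_neg, abs_of_nonpos hk']
    exact mul_le_of_le_one_right (by linarith) (hu j hj.2)
  rw [Finset.sum_neg_distrib] at hs
  have h0' : |(1 + ∑ j ∈ Finset.Ico 1 n, weight α (n - j)) * u 0 x| ≤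
      1 + ∑ j ∈ Finset.Ico 1 n, weight α (n - j) := by
    rw [abs_mul, abs_of_nonneg hw]
    exact mul_le_of_le_one_right hw (hu 0 hn)
  rw [e]
  exact (abs_add_le _ _).trans (by linarith)

lemma discreteCaputo_eq {X : Type*} (α τ : ℝ) (u : ℕ → X → ℝ) {n : ℕ} (hn : 1 ≤ n) (x : X) :
    discreteCaputo α τ u n x = τ ^ (-α) * (u n x - fracExtrap α u n x) := by
  rw [discreteCaputo, fracExtrap, ← Finset.Ico_insert_right hn, Finset.sum_insert (by simp)]
  simp only [Nat.sub_self, weight_zero]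
  ring

/-! ### Composition of `H_0^1` functions with smooth functions -/

lemma IsTestFunction.comp {d : ℕ} {Ω : Set (E d)} {φ : E d → ℝ} (hφ : IsTestFunction Ω φ)
    {F : ℝ → ℝ} (hF : ContDiff ℝ ∞ F) (hF0 : F 0 = 0) : IsTestFunction Ω (fun x => F (φ x)) :=
  ⟨hF.comp hφ.1, hφ.2.1.comp_left hF0,
    (closure_mono (Function.support_comp_subset hF0 φ)).trans hφ.2.2⟩

lemma gradient_comp {d : ℕ} {φ : E d → ℝ} {F : ℝ → ℝ} {x : E d}
    (hF : DifferentiableAt ℝ F (φ x)) (hφ : DifferentiableAt ℝ φ x) :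
    ∇ (fun y => F (φ y)) x = deriv F (φ x) • ∇ φ x := by
  have h := hF.hasDerivAt.comp_hasFDerivAt x hφ.hasFDerivAt
  have e : fderiv ℝ (fun y => F (φ y)) x = deriv F (φ x) • fderiv ℝ φ x := h.fderiv
  simp [gradient, e]

/-- Dominated convergence in `L^2` for bounded scalar multipliers. -/
lemma tendsto_eLpNorm_smul_zero {X V : Type*} [MeasurableSpace X] {μ : Measure X}
    [NormedAddCommGroup V] [NormedSpace ℝ V] {G : X → V} (hG : MemLp G 2 μ) {D : ℕ → X → ℝ}
    (hD : ∀ k, AEStronglyMeasurable (D k) μ) {C : ℝ} (hC : ∀ k x, |D k x| ≤ C)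
    (hlim : ∀ᵐ x ∂μ, Tendsto (fun k => D k x) atTop (𝓝 0)) :
    Tendsto (fun k => eLpNorm (fun x => D k x • G x) 2 μ) atTop (𝓝 0) := by
  have key : Tendsto (fun k => ∫⁻ x, ‖D k x • G x‖ₑ ^ (2 : ℝ) ∂μ) atTop
      (𝓝 (∫⁻ _, 0 ∂μ)) := by
    have hCG : MemLp (fun x => C • G x) 2 μ := hG.const_smul C
    refine tendsto_lintegral_of_dominated_convergence' (fun x => ‖C • G x‖ₑ ^ (2 : ℝ))
      (fun k => (((hD k).smul hG.1).enorm).pow_const _) (fun k => ?_) ?_ ?_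
    · refine Eventually.of_forall fun x => ENNReal.rpow_le_rpow ?_ (by norm_num)
      rw [enorm_smul, enorm_smul]
      gcongr
      exact enorm_le_iff_norm_le.2 ((hC k x).trans (le_abs_self C))
    · have := lintegral_rpow_enorm_lt_top_of_eLpNorm_lt_top (by norm_num) (by norm_num) hCG.2
      simpa using this.ne
    · filter_upwards [hlim] with x hx
      have h1 : Tendsto (fun k => ‖D k x • G x‖ₑ) atTop (𝓝 0) := by
        have := (hx.smul_const (G x)).enorm
        simpa using this
      simpa using h1.ennrpow_const 2
  have h2 := key.ennrpow_const (1 / 2)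
  simp only [lintegral_zero] at h2
  rw [ENNReal.zero_rpow_of_pos (by norm_num)] at h2
  refine h2.congr fun k => ?_
  rw [eLpNorm_eq_lintegral_rpow_enorm_toReal (by norm_num) (by norm_num)]
  simp

/-- If `φ_k` are test functions approximating `u`, then so are the `F ∘ φ_k` for `F ∘ u`: `F 0 = 0`
keeps the supports in `Ω`, and the bound on `F'` makes `F` Lipschitz. -/
lemma IsH10.comp {d : ℕ} {Ω : Set (E d)} {u : E d → ℝ} {G : E d → E d} (h : IsH10 Ω u G)
    {F : ℝ → ℝ} (hF : ContDiff ℝ ∞ F) (hF0 : F 0 = 0) {C : ℝ} (hC : ∀ s, |deriv F s| ≤ C) :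
    IsH10 Ω (fun x => F (u x)) (fun x => deriv F (u x) • G x) := by
  have hC0 : 0 ≤ C := (abs_nonneg _).trans (hC 0)
  lift C to NNReal using hC0
  have hdiff : Differentiable ℝ F := hF.differentiable (by simp)
  have hdc : Continuous (deriv F) := hF.continuous_deriv (by simp)
  have hLip : LipschitzWith C F := lipschitzWith_of_nnnorm_deriv_le hdiff fun s => hC s
  have hu := h.memLp.1
  have hG := h.memLp_grad.1
  have hdu : AEStronglyMeasurable (fun x => deriv F (u x)) (volume.restrict Ω) :=
    hdc.comp_aestronglyMeasurable hu
  obtain ⟨φ, hφ, hφu, hφG⟩ := h.approx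
  have hφm : ∀ k, AEStronglyMeasurable (φ k) (volume.restrict Ω) := fun k =>
    (hφ k).1.continuous.aestronglyMeasurable
  have hgm : ∀ k, AEStronglyMeasurable (∇ (φ k)) (volume.restrict Ω) := fun k =>
    ((InnerProductSpace.toDual ℝ (E d)).symm.continuous.comp
      ((hφ k).1.continuous_fderiv (by simp))).aestronglyMeasurable
  -- Dominated convergence for `F'(φ_k)` needs almost everywhere convergence, hence a subsequence.
  obtain ⟨ns, hns, hae⟩ : ∃ ns : ℕ → ℕ, StrictMono ns ∧
      ∀ᵐ x ∂(volume.restrict Ω), Tendsto (fun i => φ (ns i) x) atTop (𝓝 (u x)) := by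
    refine (tendstoInMeasure_of_tendsto_eLpNorm (p := 2) (by norm_num) hφm hu
      ?_).exists_seq_tendsto_ae
    refine hφu.congr fun k => ?_
    rw [← eLpNorm_neg]
    congr 1
    ext x
    simp
  refine ⟨hLip.comp_memLp hF0 h.memLp, ?_, fun k x => F (φ (ns k) x),
    fun k => (hφ _).comp hF hF0, ?_, ?_⟩
  · refine h.memLp_grad.of_le_mul (c := C) (hdu.smul hG) (Eventually.of_forall fun x => ?_)
    rw [norm_smul]
    exact mul_le_mul_of_nonneg_right (hC _) (norm_nonneg _)
  · have hz : Tendsto (fun k => ENNReal.ofReal C *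
        eLpNorm (fun x => u x - φ (ns k) x) 2 (volume.restrict Ω)) atTop (𝓝 0) := by
      simpa using ENNReal.Tendsto.const_mul (a := ENNReal.ofReal C) (hφu.comp hns.tendsto_atTop)
        (Or.inr ENNReal.ofReal_ne_top)
    refine tendsto_of_tendsto_of_tendsto_of_le_of_le tendsto_const_nhds hz (fun _ => zero_le)
      fun k => eLpNorm_le_mul_eLpNorm_of_ae_le_mul (Eventually.of_forall fun x => ?_) 2
    exact hLip.norm_sub_le _ _
  · have h1 := tendsto_eLpNorm_smul_zero (V := E d) h.memLp_grad
      (D := fun k x => deriv F (u x) - deriv F (φ (ns k) x)) (C := C + C)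
      (fun k => hdu.sub (hdc.comp_aestronglyMeasurable (hφm _)))
      (fun k x => (abs_sub _ _).trans (add_le_add (hC _) (hC _)))
      (by
        filter_upwards [hae] with x hx
        have := ((hdc.tendsto _).comp hx).const_sub (deriv F (u x))
        simpa using this)
    have h2 : Tendsto (fun k => ENNReal.ofReal C *
        eLpNorm (fun x => G x - ∇ (φ (ns k)) x) 2 (volume.restrict Ω)) atTop (𝓝 0) := by
      simpa using ENNReal.Tendsto.const_mul (a := ENNReal.ofReal C) (hφG.comp hns.tendsto_atTop)
        (Or.inr ENNReal.ofReal_ne_top)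
    have h3 := h1.add h2
    rw [add_zero] at h3
    refine tendsto_of_tendsto_of_tendsto_of_le_of_le tendsto_const_nhds h3 (fun _ => zero_le)
      fun k => ?_
    -- The first term tends to zero by dominated convergence, the second because `F'` is bounded.
    have e : (fun x => deriv F (u x) • G x - ∇ (fun y => F (φ (ns k) y)) x) =
        (fun x => (deriv F (u x) - deriv F (φ (ns k) x)) • G x) +
          fun x => deriv F (φ (ns k) x) • (G x - ∇ (φ (ns k)) x) := by
      ext1 x
      rw [gradient_comp (hdiff _) (((hφ (ns k)).1.differentiable (by simp)) x), Pi.add_apply,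
        sub_smul, smul_sub]
      abel
    have hdφ : AEStronglyMeasurable (fun x => deriv F (φ (ns k) x)) (volume.restrict Ω) :=
      hdc.comp_aestronglyMeasurable (hφm _)
    simp only [e]
    refine (eLpNorm_add_le ((hdu.sub hdφ).smul hG) (hdφ.smul (hG.sub (hgm _)))
      (by norm_num)).trans (add_le_add le_rfl ?_)
    refine eLpNorm_le_mul_eLpNorm_of_ae_le_mul (Eventually.of_forall fun x => ?_) 2
    change ‖deriv F (φ (ns k) x) • (G x - ∇ (φ (ns k)) x)‖ ≤ _
    rw [norm_smul]
    exact mul_le_mul_of_nonneg_right (hC _) (norm_nonneg _)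

/-! ### The weak maximum principle -/

/-- Testing with a monotone function of the solution. -/
lemma IsDirichletLaplacian.integral_mul_comp_nonpos {d : ℕ} {Ω : Set (E d)} {w L : E d → ℝ}
    (h : IsDirichletLaplacian Ω w L) {F : ℝ → ℝ} (hF : ContDiff ℝ ∞ F) (hF0 : F 0 = 0)
    (hmono : Monotone F) {C : ℝ} (hC : ∀ s, |deriv F s| ≤ C) :
    Integrable (fun x => L x * F (w x)) (volume.restrict Ω) ∧ ∫ x in Ω, L x * F (w x) ≤ 0 := by
  obtain ⟨hL, G, hG, hweak⟩ := h
  have hc := hG.comp hF hF0 hC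
  refine ⟨hL.integrable_mul hc.memLp, ?_⟩
  have h1 := hweak _ _ hc
  have h2 : 0 ≤ ∫ x in Ω, inner ℝ (G x) (deriv F (w x) • G x) := by
    refine integral_nonneg fun x => ?_
    rw [inner_smul_right]
    exact mul_nonneg hmono.deriv_nonneg real_inner_self_nonneg
  linarith

/-- A smooth monotone odd function vanishing exactly on `[-1, 1]`, with bounded derivative. -/
lemma exists_smooth_truncation : ∃ F : ℝ → ℝ, ContDiff ℝ ∞ F ∧ Monotone F ∧
    (∃ C, ∀ s, |deriv F s| ≤ C) ∧ (∀ s, |s| ≤ 1 → F s = 0) ∧ (∀ s, 1 < s → 0 < F s) ∧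
    ∀ s, s < -1 → F s < 0 := by
  set F : ℝ → ℝ := fun s => Real.smoothTransition (s - 1) - Real.smoothTransition (-s - 1) with hFd
  have hF : ContDiff ℝ ∞ F :=
    (Real.smoothTransition.contDiff.comp (contDiff_id.sub contDiff_const)).sub
      (Real.smoothTransition.contDiff.comp (contDiff_id.neg.sub contDiff_const))
  refine ⟨F, hF, fun a b hab => ?_, ?_, fun s hs => ?_, fun s hs => ?_, fun s hs => ?_⟩
  · exact sub_le_sub (Real.smoothTransition.monotone (by linarith))
      (Real.smoothTransition.monotone (by linarith))
  -- `F` is constant, equal to `±1`, beyond `±2`, so the continuous `F'` has compact support.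
  · refine (hF.continuous_deriv (by simp)).bounded_above_of_compact_support
      (HasCompactSupport.intro (isCompact_Icc (a := (-2 : ℝ)) (b := 2)) fun x hx => ?_)
    rw [mem_Icc, not_and_or, not_le, not_le] at hx
    rcases hx with hx | hx
    · have : F =ᶠ[𝓝 x] fun _ => -1 := by
        filter_upwards [Iio_mem_nhds hx] with y hy
        rw [mem_Iio] at hy
        simp only [hFd]
        rw [Real.smoothTransition.zero_of_nonpos (by linarith),
          Real.smoothTransition.one_of_one_le (by linarith)]
        norm_num
      rw [this.deriv_eq, deriv_const]
    · have : F =ᶠ[𝓝 x] fun _ => 1 := by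
        filter_upwards [Ioi_mem_nhds hx] with y hy
        rw [mem_Ioi] at hy
        simp only [hFd]
        rw [Real.smoothTransition.one_of_one_le (by linarith),
          Real.smoothTransition.zero_of_nonpos (by linarith)]
        norm_num
      rw [this.deriv_eq, deriv_const]
  · obtain ⟨h1, h2⟩ := abs_le.1 hs
    simp only [hFd]
    rw [Real.smoothTransition.zero_of_nonpos (by linarith),
      Real.smoothTransition.zero_of_nonpos (by linarith), sub_zero]
  · simp only [hFd]
    rw [Real.smoothTransition.zero_of_nonpos (x := -s - 1) (by linarith), sub_zero]
    exact Real.smoothTransition.pos_of_pos (by linarith)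
  · simp only [hFd]
    rw [Real.smoothTransition.zero_of_nonpos (x := s - 1) (by linarith), zero_sub]
    exact neg_neg_of_pos (Real.smoothTransition.pos_of_pos (by linarith))

/-- The function `c L F(w)` is nonnegative with nonpositive integral, so it vanishes almost
everywhere, while it is positive where `|w| > 1`. The case `c = 0`, that is `κ = 0`, is included. -/
lemma IsDirichletLaplacian.ae_abs_le_one {d : ℕ} {Ω : Set (E d)} {w L : E d → ℝ}
    (h : IsDirichletLaplacian Ω w L) {c : ℝ} (hc : 0 ≤ c)
    (hpos : ∀ᵐ x ∂(volume.restrict Ω), 1 < w x → 0 < c * L x)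
    (hneg : ∀ᵐ x ∂(volume.restrict Ω), w x < -1 → c * L x < 0) :
    ∀ᵐ x ∂(volume.restrict Ω), |w x| ≤ 1 := by
  obtain ⟨F, hF, hmono, ⟨C, hC⟩, hFz, hFp, hFn⟩ := exists_smooth_truncation
  obtain ⟨hint, hle⟩ := h.integral_mul_comp_nonpos hF (hFz 0 (by simp)) hmono hC
  have hsign : ∀ᵐ x ∂(volume.restrict Ω), 0 ≤ c * (L x * F (w x)) ∧
      (c * (L x * F (w x)) = 0 → |w x| ≤ 1) := by
    filter_upwards [hpos, hneg] with x hx hx'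
    rcases le_or_gt |w x| 1 with h1 | h1
    · simp [hFz _ h1, h1]
    · have : 0 < c * L x * F (w x) := by
        rcases lt_abs.1 h1 with h2 | h2
        · exact mul_pos (hx h2) (hFp _ h2)
        · exact mul_pos_of_neg_of_neg (hx' (by linarith)) (hFn _ (by linarith))
      rw [← mul_assoc]
      exact ⟨this.le, fun h0 => absurd h0 this.ne'⟩
  have hzero : ∫ x in Ω, c * (L x * F (w x)) = 0 := by
    refine le_antisymm ?_ (integral_nonneg_of_ae (hsign.mono fun x hx => hx.1))
    rw [integral_const_mul]
    exact mul_nonpos_of_nonneg_of_nonpos hc hle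
  have := (integral_eq_zero_iff_of_nonneg_ae (hsign.mono fun x hx => hx.1)
    (hint.const_mul c)).1 hzero
  filter_upwards [hsign, this] with x hx hx0
  exact hx.2 hx0

lemma eLpNorm_top_le_one_iff {X : Type*} [MeasurableSpace X] {μ : Measure X} {f : X → ℝ} :
    eLpNorm f ∞ μ ≤ 1 ↔ ∀ᵐ x ∂μ, |f x| ≤ 1 := by
  rw [eLpNorm_exponent_top]
  constructor
  · intro h
    filter_upwards [ae_le_eLpNormEssSup (f := f) (μ := μ)] with x hx
    have := hx.trans h
    rw [← ofReal_norm] at this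
    simpa using this
  · intro h
    simpa using eLpNormEssSup_le_of_ae_bound (f := f) (C := 1) h

/-- Maximum-norm stability of a time-stepping scheme whose elliptic equation at each step satisfies
the sign conditions of the maximum principle. -/
lemma eLpNorm_top_le_one_of_step {d : ℕ} {Ω : Set (E d)} {α κ : ℝ} (h0 : 0 < α) (h1 : α < 1)
    {N : ℕ} {u : ℕ → E d → ℝ} (hu0 : eLpNorm (u 0) ∞ (volume.restrict Ω) ≤ 1)
    (hstep : ∀ n, 1 ≤ n → n ≤ N → ∃ L, IsDirichletLaplacian Ω (u n) L ∧
      ∀ᵐ x ∂(volume.restrict Ω), |fracExtrap α u n x| ≤ 1 →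
        (1 < u n x → 0 < κ ^ 2 * L x) ∧ (u n x < -1 → κ ^ 2 * L x < 0))
    (n : ℕ) (hn : n ≤ N) : eLpNorm (u n) ∞ (volume.restrict Ω) ≤ 1 := by
  induction n using Nat.strong_induction_on with
  | _ n ih =>
  rcases Nat.eq_zero_or_pos n with rfl | hpos
  · exact hu0
  rw [eLpNorm_top_le_one_iff]
  obtain ⟨L, hL, hx⟩ := hstep n hpos hn
  have hprev : ∀ᵐ x ∂(volume.restrict Ω), ∀ j < n, |u j x| ≤ 1 := by
    rw [ae_all_iff]
    intro j
    by_cases hj : j < n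
    · filter_upwards [eLpNorm_top_le_one_iff.1 (ih j hj (hj.le.trans hn))] with x hx _ using hx
    · exact Eventually.of_forall fun x h => absurd h hj
  refine hL.ae_abs_le_one (sq_nonneg κ) ?_ ?_
  · filter_upwards [hx, hprev] with x hx hp
    exact (hx (abs_fracExtrap_le_one h0 h1 hpos hp)).1
  · filter_upwards [hx, hprev] with x hx hp
    exact (hx (abs_fracExtrap_le_one h0 h1 hpos hp)).2

end FracAllenCahn

theorem mainTheorem7 {d : ℕ} (Ω : Set (FracAllenCahn.E d)) (hΩ : IsOpen Ω)
    (α κ T τ : ℝ) (hα0 : 0 < α) (hα1 : α < 1) (hT : 0 < T)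
    (N : ℕ) (hN : 0 < N) (hτ : τ = T / (N : ℝ)) :
    (∀ u : ℕ → FracAllenCahn.E d → ℝ,
      AEStronglyMeasurable (u 0) (volume.restrict Ω) →
      FracAllenCahn.IsWCS Ω α κ τ N u →
      eLpNorm (u 0) ∞ (volume.restrict Ω) ≤ 1 →
      ∀ n : ℕ, 1 ≤ n → n ≤ N → eLpNorm (u n) ∞ (volume.restrict Ω) ≤ 1) ∧
    (∀ S : ℝ, 0 < S → 2 ≤ S + τ ^ (-α) →
      ∀ u : ℕ → FracAllenCahn.E d → ℝ,
      AEStronglyMeasurable (u 0) (volume.restrict Ω) →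
      FracAllenCahn.IsLWS Ω α κ τ S N u →
      eLpNorm (u 0) ∞ (volume.restrict Ω) ≤ 1 →
      ∀ n : ℕ, 1 ≤ n → n ≤ N → eLpNorm (u n) ∞ (volume.restrict Ω) ≤ 1) := by
  have hτ0 : 0 < τ := hτ ▸ div_pos hT (Nat.cast_pos.2 hN)
  have hl : 0 < τ ^ (-α) := Real.rpow_pos_of_pos hτ0 _
  refine ⟨fun u _ hs hu0 n _ hn => ?_, fun S hS hSτ u _ hs hu0 n _ hn => ?_⟩
  · refine FracAllenCahn.eLpNorm_top_le_one_of_step (κ := κ) hα0 hα1 hu0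
      (fun n hn1 hnN => ?_) n hn
    obtain ⟨L, hL, hx⟩ := hs n hn1 hnN
    refine ⟨L, hL, hx.mono fun x hx he => ?_⟩
    rw [FracAllenCahn.discreteCaputo_eq α τ u hn1] at hx
    set e := FracAllenCahn.fracExtrap α u n x
    set w := u n x
    obtain ⟨he1, he2⟩ := abs_le.1 he
    constructor
    · intro hw
      -- Here `κ²L = τ^{-α}(w - e) + (w³ - e)`, and both terms are positive since `e ≤ 1 < w`.
      have h1 : 0 < τ ^ (-α) * (w - e) := mul_pos hl (by linarith)
      have h2 : 1 < w ^ 3 := one_lt_pow₀ hw (by norm_num)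
      linarith
    · intro hw
      have h1 : 0 < τ ^ (-α) * (e - w) := mul_pos hl (by linarith)
      have h2 : 1 < (-w) ^ 3 := one_lt_pow₀ (by linarith) (by norm_num)
      have h3 : (-w) ^ 3 = -w ^ 3 := by ring
      linarith
  · refine FracAllenCahn.eLpNorm_top_le_one_of_step (κ := κ) hα0 hα1 hu0
      (fun n hn1 hnN => ?_) n hn
    obtain ⟨L, hL, hx⟩ := hs n hn1 hnN
    refine ⟨L, hL, hx.mono fun x hx he => ?_⟩
    rw [FracAllenCahn.discreteCaputo_eq α τ u hn1] at hx
    set e := FracAllenCahn.fracExtrap α u n x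
    set w := u n x
    set l := τ ^ (-α)
    obtain ⟨he1, he2⟩ := abs_le.1 he
    have hlS : 0 < S + l := by linarith
    constructor
    · intro hw
      -- Here `κ²L = (S + l)(w - e) - e + e³ = (S + l)(w - 1) + (1 - e)(S + l - e - e²)`. The
      -- threshold `2` is the maximum of `e + e²` on `[-1, 1]`.
      have h1 : 0 < (S + l) * (w - 1) := mul_pos hlS (by linarith)
      have h2 : 0 ≤ (1 - e) * (S + l - e - e ^ 2) :=
        mul_nonneg (by linarith) (by nlinarith)
      nlinarith
    · intro hw
      have h1 : 0 < (S + l) * (-1 - w) := mul_pos hlS (by linarith)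
      have h2 : 0 ≤ (1 + e) * (S + l + e - e ^ 2) :=
        mul_nonneg (by linarith) (by nlinarith)
      nlinarith
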